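/- Let $d\in\mathbb N$ and let $(X_i)_{i\ge 0}$ be a (strictly) stationary ergodic sequence of random vectors with values in $\mathbb R^d$, defined on a probability space $(\Omega,\mathcal A,\mathbb P)$; that is, the law of $(X_i)_{i\ge 0}$ on $(\mathbb R^d)^{\mathbb N}$ is invariant and ergodic under the left shift. Let $F$ be the distribution of $X_1$, and let $h\colon\mathbb R^d\times\mathbb R^d\to\mathbb R$ be a measurable function such that the family $\{h(X_1,X_j),\ j\ge 1\}$ is uniformly integrable. Assume that one of the following two assumptions is satisfied: (A.1) $h$ is continuous at $F\times F$-almost every point of $\mathbb R^d\times\mathbb R^d$, and $h$ is symmetric, i.e. $h(x,y)=h(y,x)$ for all $x,y\in\mathbb R^d$; (A.2) $\int_{\mathbb R^d}\int_{\mathbb R^d}|h(x,y)|\,dF(x)\,dF(y)<\infty$, the random vector $X_0$ has a bounded density with respect to the Lebesgue measure on $\mathbb R^d$, and for each $k\ge 1$ the vector $(X_0,X_k)$ has a density $f_k$ with respect to the Lebesgue measure on $\mathbb R^d\times\mathbb R^d$, with $\sup_{k\ge 1}\sup_{s,t\in\mathbb R^d}f_k(s,t)<\infty$. Then $h$ is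 $F\times F$-integrable, the random variables $\sum_{1\le i<j\le n}h(X_i,X_j)$, $n\ge 2$, are integrable, and $$\lim_{n\to\infty}\mathbb E\left[\left|\frac{1}{\binom n2}\sum_{1\le i<j\le n}h(X_i,X_j)-\int_{\mathbb R^d}\int_{\mathbb R^d}h(x,y)\,dF(x)\,dF(y)\right|\right]=0.$$ -/

import Mathlib

open MeasureTheory Filter Topology
open scoped ENNReal NNReal

/-- The left shift `(x₀, x₁, x₂, …) ↦ (x₁, x₂, x₃, …)` on the space of sequences. -/
def seqShift {E : Type*} (x : ℕ → E) : ℕ → E := fun i => x (i + 1)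

/-- The law, on the sequence space with its product `σ`-algebra, of a process `(X i)_{i ≥ 0}`. -/
noncomputable def processLaw {Ω E : Type*} [MeasurableSpace Ω] [MeasurableSpace E]
    (X : ℕ → Ω → E) (P : Measure Ω) : Measure (ℕ → E) :=
  P.map (fun ω i => X i ω)

/-- A process of random elements is stationary and ergodic if the left shift preserves its law
(strict stationarity) and every shift-invariant event of the sequence space has probability zero
or one; both parts are contained in `Ergodic`. -/
structure IsStationaryErgodic {Ω E : Type*} [MeasurableSpace Ω] [MeasurableSpace E]
    (X : ℕ → Ω → E) (P : Measure Ω) : Prop where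
  measurable : ∀ i, Measurable (X i)
  ergodic_shift : Ergodic seqShift (processLaw X P)

/-- `f` is a density of the measure `Q` with respect to the Lebesgue measure. -/
def IsLebesgueDensity {E : Type*} [MeasureSpace E] (f : E → ℝ≥0∞) (Q : Measure E) : Prop :=
  Measurable f ∧ Q = (volume : Measure E).withDensity f

/-- The `U`-statistic of order two with kernel `h`, built on `X 1, …, X n`. -/
noncomputable def uStatistic {Ω E : Type*} (h : E × E → ℝ) (X : ℕ → Ω → E) (n : ℕ) (ω : Ω) : ℝ :=
  ((n.choose 2 : ℕ) : ℝ)⁻¹ *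
    ∑ i ∈ Finset.Icc 1 n, ∑ j ∈ Finset.Ioc i n, h (X i ω, X j ω)

/-!
The proof rests on von Neumann's mean ergodic theorem and on an approximation argument; no pointwise
ergodic theorem and no weak convergence of empirical measures enter.

A kernel is said to obey the law of large numbers (`IsLLNKernel`) when its `U`-statistics converge
in `L¹` to its integral under `F × F`. For a bounded tensor product `u ⊗ v`, the sum of the centred
kernel over pairs `i < j` is controlled by the centred partial sums of `u (X i)` and of `v (X i)`,
which are `o(n)` in `L¹` by the mean ergodic theorem for the shift. Hence the sum is `o(n²)` in `L¹`
(`IsStationaryErgodic.isLLNKernel_mul`). The class of such kernels is linear, so it contains every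
simple function over measurable rectangles.

A bounded, `F × F`-almost everywhere continuous kernel `h` is then squeezed
(`IsStationaryErgodic.isLLNKernel_of_ae_continuousAt`). By second countability, finitely many open
rectangles on which `h` oscillates by at most `ε` cover the product space up to a set
`D` of `F × F`-measure at most `ε`. Thus `h` differs from a simple function by at most `ε + K 1_D`,
and `1_D` is itself a simple function over rectangles, so the `U`-statistic of the error has
asymptotic mean at most `(1 + K) ε`.

Unbounded kernels are truncated. By stationarity the law of `(X i, X j)` depends on `j - i` only, so
uniform integrability makes the truncation errors small along all pairs simultaneously
(`IsStationaryErgodic.isLLNKernel_of_clamp`). For almost everywhere continuous kernels, the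
`F × F`-integrability is a consequence: the integrals of the truncations of `|h|` are limits of
means of `U`-statistics, hence bounded, and Fatou's lemma applies.

When the pair densities are bounded, a bounded kernel is first restricted to a large ball and then
approximated in `L¹` of Lebesgue measure by a compactly supported continuous kernel. The density
bound turns this into an approximation in `L¹` of all pair laws and of `F × F`, which reduces the
claim to the continuous case.
-/

/-! ### The mean ergodic theorem in `L¹` -/

/-- The `L¹` mean ergodic theorem: von Neumann's theorem for the Koopman operator on `L²`, whose
invariant functions are constant by ergodicity. -/
theorem Ergodic.tendsto_integral_abs_birkhoffAverage {α : Type*} [MeasurableSpace α]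
    {μ : Measure α} [IsProbabilityMeasure μ] {T : α → α} (hT : Ergodic T μ) {g : α → ℝ}
    (hg : MemLp g 2 μ) :
    Tendsto (fun n : ℕ => ∫ x, |birkhoffAverage ℝ T g n x - ∫ y, g y ∂μ| ∂μ) atTop (𝓝 0) := by
  have hT' := hT.toMeasurePreserving
  -- The Koopman operator of `T` on `L²` and its projection onto the invariant functions.
  let U : Lp ℝ 2 μ →ₗᵢ[ℝ] Lp ℝ 2 μ := Lp.compMeasurePreservingₗᵢ ℝ T hT'
  let S := U.toContinuousLinearMap.eqLocus (1 : Lp ℝ 2 μ →L[ℝ] Lp ℝ 2 μ)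
  have hlim := U.toContinuousLinearMap.tendsto_birkhoffAverage_orthogonalProjection
    U.norm_toContinuousLinearMap_le (hg.toLp g)
  set w := S.orthogonalProjectionOnto (hg.toLp g)
  have hw_fix : Lp.compMeasurePreserving T hT' (w : Lp ℝ 2 μ) = w := w.2
  obtain ⟨c, hc⟩ : ∃ c : ℝ, (w : Lp ℝ 2 μ) =ᵐ[μ] Function.const α c := by
    refine hT.ae_eq_const_of_ae_eq_comp_ae (Lp.aestronglyMeasurable _) ?_
    refine (Lp.coeFn_compMeasurePreserving _ hT').symm.trans ?_
    rw [hw_fix]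
  have hiter : ∀ n, (U.toContinuousLinearMap^[n] (hg.toLp g) : Lp ℝ 2 μ) =ᵐ[μ] g ∘ T^[n] := by
    intro n
    induction n with
    | zero => simpa using hg.coeFn_toLp
    | succ n ih =>
      rw [Function.iterate_succ_apply', Function.iterate_succ]
      refine (Lp.coeFn_compMeasurePreserving _ hT').trans ?_
      exact hT'.quasiMeasurePreserving.ae_eq_comp ih
  have havg : ∀ n, ((birkhoffAverage ℝ U.toContinuousLinearMap _root_.id n (hg.toLp g) :
      Lp ℝ 2 μ) : α → ℝ) =ᵐ[μ] birkhoffAverage ℝ T g n := by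
    intro n
    have hsum : ((birkhoffSum U.toContinuousLinearMap _root_.id n (hg.toLp g) :
      Lp ℝ 2 μ) : α → ℝ) =ᵐ[μ] birkhoffSum T g n := by
      induction n with
      | zero => simpa [birkhoffSum] using Lp.coeFn_zero ℝ 2 μ
      | succ n ih =>
        rw [birkhoffSum_succ]
        refine (Lp.coeFn_add _ _).trans ?_
        filter_upwards [ih, hiter n] with x h1 h2
        simp only [Pi.add_apply, h1, birkhoffSum_succ, _root_.id, h2, Function.comp]
    refine (Lp.coeFn_smul _ _).trans ?_
    filter_upwards [hsum] with x hx
    exact congrArg ((n : ℝ)⁻¹ • ·) hx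
  have hmem : ∀ n, MemLp (birkhoffAverage ℝ T g n) 2 μ := fun n =>
    (memLp_congr_ae (havg n)).1 (Lp.memLp _)
  -- `L²` convergence to the constant `c` yields `L¹` convergence to it.
  have h2 : Tendsto (fun n : ℕ => eLpNorm (birkhoffAverage ℝ T g n - fun _ => c) 2 μ)
      atTop (𝓝 0) := by
    have := (Lp.tendsto_Lp_iff_tendsto_eLpNorm' _ _).1 hlim
    refine this.congr fun n => eLpNorm_congr_ae ?_
    exact (havg n).sub hc
  have h1 : Tendsto (fun n : ℕ => ∫ x, |birkhoffAverage ℝ T g n x - c| ∂μ) atTop (𝓝 0) := by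
    have h1' : Tendsto (fun n : ℕ => eLpNorm (birkhoffAverage ℝ T g n - fun _ => c) 1 μ)
        atTop (𝓝 0) := by
      refine tendsto_of_tendsto_of_tendsto_of_le_of_le tendsto_const_nhds h2 (fun _ => zero_le)
        fun n => ?_
      exact eLpNorm_le_eLpNorm_of_exponent_le (by norm_num)
        ((hmem n).1.sub aestronglyMeasurable_const)
    have h1'' := (ENNReal.tendsto_toReal ENNReal.zero_ne_top).comp h1'
    refine h1''.congr fun n => ?_
    rw [Function.comp, eLpNorm_one_eq_lintegral_enorm,
      ← integral_norm_eq_lintegral_enorm ((hmem n).1.sub aestronglyMeasurable_const)]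
    rfl
  -- Since `T` preserves integrals, `c` is the integral of `g`.
  have hint : ∀ k, Integrable (fun x => g (T^[k] x)) μ := fun k =>
    ((hT'.iterate k).integrable_comp hg.1).2 (hg.integrable (by norm_num))
  have hmean : ∀ n : ℕ, 0 < n → ∫ x, birkhoffAverage ℝ T g n x ∂μ = ∫ y, g y ∂μ := by
    intro n hn
    simp only [birkhoffAverage, birkhoffSum, integral_smul]
    rw [integral_finsetSum _ fun k _ => hint k]
    have : ∀ k ∈ Finset.range n, ∫ x, g (T^[k] x) ∂μ = ∫ y, g y ∂μ := by
      intro k _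
      have := integral_map (hT'.iterate k).measurable.aemeasurable (f := g) (μ := μ)
        (by rw [(hT'.iterate k).map_eq]; exact hg.1)
      rw [← this, (hT'.iterate k).map_eq]
    rw [Finset.sum_congr rfl this]
    have hn' : (n : ℝ) ≠ 0 := by positivity
    simp [hn']
  have hcval : ∫ y, g y ∂μ = c := by
    have hle : ∀ᶠ n : ℕ in atTop,
        |(∫ y, g y ∂μ) - c| ≤ ∫ x, |birkhoffAverage ℝ T g n x - c| ∂μ := by
      filter_upwards [eventually_gt_atTop 0] with n hn
      have : (∫ y, g y ∂μ) - c = ∫ x, (birkhoffAverage ℝ T g n x - c) ∂μ := by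
        rw [integral_sub ((hmem n).integrable (by norm_num)) (integrable_const _), hmean n hn]
        simp
      rw [this]
      exact abs_integral_le_integral_abs
    have := ge_of_tendsto h1 hle
    exact sub_eq_zero.1 (abs_eq_zero.1 (le_antisymm this (abs_nonneg _)))
  rwa [hcval]

/-! ### Stationary ergodic processes -/

theorem seqShift_iterate_apply {E : Type*} (k i : ℕ) (x : ℕ → E) :
    seqShift^[k] x i = x (i + k) := by
  induction k generalizing x with
  | zero => rfl
  | succ k ih => rw [Function.iterate_succ_apply, ih]; simp only [seqShift]; congr 1

section StationaryErgodic

variable {Ω E : Type*} [MeasurableSpace Ω] [MeasurableSpace E] {P : Measure Ω}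
  {X : ℕ → Ω → E}

theorem measurable_seqShift : Measurable (seqShift : (ℕ → E) → ℕ → E) :=
  measurable_pi_lambda _ fun i => measurable_pi_apply (i + 1)

namespace IsStationaryErgodic

theorem measurable_path (hX : IsStationaryErgodic X P) : Measurable fun ω i => X i ω :=
  measurable_pi_lambda _ hX.measurable

theorem measurable_pair (hX : IsStationaryErgodic X P) (i j : ℕ) :
    Measurable fun ω => (X i ω, X j ω) :=
  (hX.measurable i).prodMk (hX.measurable j)

/-- The law of a pair depends on the lag only. -/
theorem map_pair_add (hX : IsStationaryErgodic X P) (i j k : ℕ) :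
    P.map (fun ω => (X (i + k) ω, X (j + k) ω)) = P.map (fun ω => (X i ω, X j ω)) := by
  have hpair : ∀ i j : ℕ, Measurable fun x : ℕ → E => (x i, x j) := fun i j =>
    (measurable_pi_apply i).prodMk (measurable_pi_apply j)
  have h := (hX.ergodic_shift.toMeasurePreserving.iterate k).map_eq
  have h2 := congrArg (Measure.map fun x : ℕ → E => (x i, x j)) h
  rw [Measure.map_map (hpair i j) (measurable_seqShift.iterate k), processLaw,
    Measure.map_map ((hpair i j).comp (measurable_seqShift.iterate k)) hX.measurable_path,
    Measure.map_map (hpair i j) hX.measurable_path] at h2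
  simpa only [Function.comp_def, seqShift_iterate_apply] using h2

theorem map_eq (hX : IsStationaryErgodic X P) (i : ℕ) : P.map (X i) = P.map (X 0) := by
  have h := congrArg (Measure.map Prod.fst) (hX.map_pair_add 0 0 i)
  rw [Measure.map_map measurable_fst (hX.measurable_pair _ _),
    Measure.map_map measurable_fst (hX.measurable_pair _ _)] at h
  simpa [Function.comp_def] using h

/-- The mean ergodic theorem for a bounded observable of the process, as a bound on centred
partial sums. -/
theorem integral_abs_sum_isLittleO [IsProbabilityMeasure P] (hX : IsStationaryErgodic X P)
    {g : E → ℝ} (hg : Measurable g) {K : ℝ} (hK : ∀ x, |g x| ≤ K) :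
    (fun n : ℕ => ∫ ω, |∑ i ∈ Finset.Icc 1 n, (g (X i ω) - ∫ x, g x ∂(P.map (X 1)))| ∂P)
      =o[atTop] fun n : ℕ => (n : ℝ) := by
  set μ := processLaw X P with hμ
  have : IsProbabilityMeasure μ :=
    Measure.isProbabilityMeasure_map hX.measurable_path.aemeasurable
  have hG : Measurable fun x : ℕ → E => g (x 1) := hg.comp (measurable_pi_apply 1)
  have hmem : MemLp (fun x : ℕ → E => g (x 1)) 2 μ :=
    MemLp.of_bound hG.aestronglyMeasurable K (Eventually.of_forall fun x => hK _)
  have hlim := hX.ergodic_shift.tendsto_integral_abs_birkhoffAverage hmem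
  have hmean : ∫ x, g (x 1) ∂μ = ∫ x, g x ∂(P.map (X 1)) := by
    rw [hμ, processLaw, integral_map hX.measurable_path.aemeasurable hG.aestronglyMeasurable,
      integral_map (hX.measurable 1).aemeasurable hg.aestronglyMeasurable]
  rw [hmean] at hlim
  set a := ∫ x, g x ∂(P.map (X 1)) with ha
  rw [Asymptotics.isLittleO_iff_tendsto' (by
    filter_upwards [eventually_gt_atTop 0] with n hn h0
    simp at h0; omega)]
  refine hlim.congr' ?_
  filter_upwards [eventually_gt_atTop 0] with n hn
  have hn' : (0 : ℝ) < n := by exact_mod_cast hn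
  have hbm : Measurable fun x : ℕ → E =>
      |birkhoffAverage ℝ seqShift (fun x : ℕ → E => g (x 1)) n x - a| := by
    have : Measurable fun x : ℕ → E =>
        birkhoffSum seqShift (fun x : ℕ → E => g (x 1)) n x :=
      Finset.measurable_fun_sum _ fun k _ => hG.comp (measurable_seqShift.iterate k)
    exact ((this.const_mul ((n : ℝ)⁻¹)).sub_const a).norm
  rw [processLaw, integral_map hX.measurable_path.aemeasurable hbm.aestronglyMeasurable,
    eq_div_iff hn'.ne', ← integral_mul_const]
  refine integral_congr_ae (Eventually.of_forall fun ω => ?_)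
  have key : birkhoffAverage ℝ seqShift (fun x : ℕ → E => g (x 1)) n (fun i => X i ω) - a =
      (n : ℝ)⁻¹ * ∑ i ∈ Finset.Icc 1 n, (g (X i ω) - a) := by
    rw [Finset.sum_sub_distrib, mul_sub]
    congr 1
    · simp only [birkhoffAverage, birkhoffSum, smul_eq_mul, seqShift_iterate_apply]
      congr 1
      rw [← Finset.Ico_add_one_right_eq_Icc, Finset.sum_Ico_eq_sum_range]
      simp
    · simp [hn'.ne']
  simp only [key, abs_mul, abs_inv, abs_of_pos hn']
  field_simp

end IsStationaryErgodic

end StationaryErgodic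

/-! ### Sums over ordered pairs and elementary properties of `U`-statistics -/

theorem Finset.sum_Icc_sum_Ioc_eq_sum_range {M : Type*} [AddCommMonoid M] (n : ℕ)
    (f : ℕ → ℕ → M) :
    ∑ i ∈ Finset.Icc 1 n, ∑ j ∈ Finset.Ioc i n, f i j =
      ∑ k ∈ Finset.range n, ∑ i ∈ Finset.Icc 1 k, f i (k + 1) := by
  rw [Finset.sum_comm' (t' := Finset.Icc 1 n) (s' := fun j => Finset.Icc 1 (j - 1))
    (by intro i j; simp only [Finset.mem_Icc, Finset.mem_Ioc]; omega),
    ← Finset.Ico_add_one_right_eq_Icc, Finset.sum_Ico_eq_sum_range]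
  simp [add_comm 1]

theorem Nat.sum_Icc_sum_Ioc_const (n : ℕ) (c : ℝ) :
    ∑ i ∈ Finset.Icc 1 n, ∑ _j ∈ Finset.Ioc i n, c = (n.choose 2 : ℕ) * c := by
  rw [Finset.sum_Icc_sum_Ioc_eq_sum_range n fun _ _ => c]
  simp only [Finset.sum_const, Nat.card_Icc, add_tsub_cancel_right, nsmul_eq_mul]
  rw [← Finset.sum_mul, ← Nat.cast_sum, Finset.sum_range_id, Nat.choose_two_right]

theorem Nat.sq_isBigO_choose_two :
    (fun n : ℕ => (n : ℝ) ^ 2) =O[atTop] fun n : ℕ => ((n.choose 2 : ℕ) : ℝ) := by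
  refine Asymptotics.IsBigO.of_bound 4 ?_
  filter_upwards [eventually_ge_atTop 2] with n hn
  have hn' : (2 : ℝ) ≤ n := by exact_mod_cast hn
  rw [Nat.cast_choose_two, Real.norm_of_nonneg (by positivity),
    Real.norm_of_nonneg (by nlinarith)]
  nlinarith

section UStatistic

variable {Ω E : Type*} {X : ℕ → Ω → E}

theorem uStatistic_add (f g : E × E → ℝ) (n : ℕ) (ω : Ω) :
    uStatistic (f + g) X n ω = uStatistic f X n ω + uStatistic g X n ω := by
  simp only [uStatistic, Pi.add_apply, Finset.sum_add_distrib, mul_add]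

theorem uStatistic_smul (c : ℝ) (f : E × E → ℝ) (n : ℕ) (ω : Ω) :
    uStatistic (c • f) X n ω = c * uStatistic f X n ω := by
  simp only [uStatistic, Pi.smul_apply, smul_eq_mul, ← Finset.mul_sum]
  ring

theorem uStatistic_sub (f g : E × E → ℝ) (n : ℕ) (ω : Ω) :
    uStatistic (f - g) X n ω = uStatistic f X n ω - uStatistic g X n ω := by
  simp only [uStatistic, Pi.sub_apply, Finset.sum_sub_distrib, mul_sub]

theorem abs_uStatistic_le {f g : E × E → ℝ} (hfg : ∀ z, |f z| ≤ g z) (n : ℕ) (ω : Ω) :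
    |uStatistic f X n ω| ≤ uStatistic g X n ω := by
  rw [uStatistic, uStatistic, abs_mul, abs_of_nonneg (by positivity)]
  gcongr
  refine (Finset.abs_sum_le_sum_abs _ _).trans (Finset.sum_le_sum fun i _ => ?_)
  exact (Finset.abs_sum_le_sum_abs _ _).trans (Finset.sum_le_sum fun j _ => hfg _)

variable [MeasurableSpace Ω] {P : Measure Ω}

theorem integrable_uStatistic {f : E × E → ℝ}
    (hf : ∀ i j, 1 ≤ i → i < j → Integrable (fun ω => f (X i ω, X j ω)) P) (n : ℕ) :
    Integrable (uStatistic f X n) P := by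
  refine Integrable.const_mul (integrable_finsetSum _ fun i hi =>
    integrable_finsetSum _ fun j hj => ?_) _
  exact hf i j (Finset.mem_Icc.1 hi).1 (Finset.mem_Ioc.1 hj).1

/-- A `U`-statistic is a mean over pairs, so a uniform bound on `E |f (X i, X j)|` passes to it. -/
theorem integral_abs_uStatistic_le {f : E × E → ℝ}
    (hf : ∀ i j, 1 ≤ i → i < j → Integrable (fun ω => f (X i ω, X j ω)) P) {C : ℝ} (hC : 0 ≤ C)
    (hfC : ∀ i j, 1 ≤ i → i < j → ∫ ω, |f (X i ω, X j ω)| ∂P ≤ C) (n : ℕ) :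
    ∫ ω, |uStatistic f X n ω| ∂P ≤ C := by
  have hf' : ∀ i j, 1 ≤ i → i < j → Integrable (fun ω => |f (X i ω, X j ω)|) P :=
    fun i j hi hj => (hf i j hi hj).abs
  calc ∫ ω, |uStatistic f X n ω| ∂P
      ≤ ∫ ω, uStatistic (fun z => |f z|) X n ω ∂P :=
        integral_mono (integrable_uStatistic hf n).abs (integrable_uStatistic hf' n)
          fun ω => abs_uStatistic_le (fun _ => le_rfl) n ω
    _ = ((n.choose 2 : ℕ) : ℝ)⁻¹ *
        ∑ i ∈ Finset.Icc 1 n, ∑ j ∈ Finset.Ioc i n, ∫ ω, |f (X i ω, X j ω)| ∂P := by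
        simp only [uStatistic]
        rw [integral_const_mul, integral_finsetSum _ fun i hi => integrable_finsetSum _ fun j hj =>
          hf' i j (Finset.mem_Icc.1 hi).1 (Finset.mem_Ioc.1 hj).1]
        congr 1
        refine Finset.sum_congr rfl fun i hi => integral_finsetSum _ fun j hj =>
          hf' i j (Finset.mem_Icc.1 hi).1 (Finset.mem_Ioc.1 hj).1
    _ ≤ ((n.choose 2 : ℕ) : ℝ)⁻¹ * ∑ i ∈ Finset.Icc 1 n, ∑ _j ∈ Finset.Ioc i n, C := by
        gcongr with i hi j hj
        exact hfC i j (Finset.mem_Icc.1 hi).1 (Finset.mem_Ioc.1 hj).1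
    _ ≤ C := by
        rw [Nat.sum_Icc_sum_Ioc_const, ← mul_assoc]
        exact mul_le_of_le_one_left hC inv_mul_le_one

end UStatistic

/-! ### Kernels satisfying the law of large numbers -/

section Kernel

variable {Ω E : Type*} [MeasurableSpace Ω] [MeasurableSpace E] {P : Measure Ω}
  {X : ℕ → Ω → E}

/-- The kernel `h` satisfies the `L¹` law of large numbers for `U`-statistics of the process `X`,
whose one-dimensional law is `P.map (X 1)`. The integrability of `h` under the product law and along
the pairs `(X i, X j)` with `1 ≤ i < j` is part of the notion, so that all integrals involved are
genuine. -/
structure IsLLNKernel (X : ℕ → Ω → E) (P : Measure Ω) (h : E × E → ℝ) : Prop where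
  integrable_prod : Integrable h ((P.map (X 1)).prod (P.map (X 1)))
  integrable_pair : ∀ i j, 1 ≤ i → i < j → Integrable (fun ω => h (X i ω, X j ω)) P
  tendsto : Tendsto (fun n : ℕ => ∫ ω, |uStatistic h X n ω -
    ∫ z, h z ∂((P.map (X 1)).prod (P.map (X 1)))| ∂P) atTop (𝓝 0)

namespace IsLLNKernel

theorem smul {f : E × E → ℝ} (c : ℝ) (hf : IsLLNKernel X P f) : IsLLNKernel X P (c • f) := by
  refine ⟨hf.integrable_prod.smul c, fun i j hi hj => (hf.integrable_pair i j hi hj).smul c, ?_⟩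
  have hlim := hf.tendsto.const_mul |c|
  rw [mul_zero] at hlim
  refine hlim.congr fun n => ?_
  rw [← integral_const_mul]
  refine integral_congr_ae (Eventually.of_forall fun ω => ?_)
  simp only [uStatistic_smul, Pi.smul_apply, smul_eq_mul]
  rw [integral_const_mul, ← mul_sub, abs_mul]

variable [IsProbabilityMeasure P] {f g h : E × E → ℝ}

theorem add (hf : IsLLNKernel X P f) (hg : IsLLNKernel X P g) : IsLLNKernel X P (f + g) := by
  have hp : ∀ i j, 1 ≤ i → i < j → Integrable (fun ω => (f + g) (X i ω, X j ω)) P :=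
    fun i j hi hj => (hf.integrable_pair i j hi hj).add (hg.integrable_pair i j hi hj)
  refine ⟨hf.integrable_prod.add hg.integrable_prod, hp, ?_⟩
  refine squeeze_zero (fun n => integral_nonneg fun ω => abs_nonneg _) (fun n => ?_)
    (by simpa using hf.tendsto.add hg.tendsto)
  have h1 := ((integrable_uStatistic hf.integrable_pair n).sub
    (integrable_const (∫ z, f z ∂((P.map (X 1)).prod (P.map (X 1)))))).abs
  have h2 := ((integrable_uStatistic hg.integrable_pair n).sub
    (integrable_const (∫ z, g z ∂((P.map (X 1)).prod (P.map (X 1)))))).abs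
  refine le_trans (integral_mono ?_ (h1.add h2) fun ω => ?_) (integral_add h1 h2).le
  · exact ((integrable_uStatistic hp n).sub (integrable_const _)).abs
  · simp only [Pi.add_apply, Pi.sub_apply]
    rw [uStatistic_add, integral_add hf.integrable_prod hg.integrable_prod, add_sub_add_comm]
    exact abs_add_le _ _

/-- The means of `U`-statistics converge. -/
theorem tendsto_integral (hf : IsLLNKernel X P f) :
    Tendsto (fun n : ℕ => ∫ ω, uStatistic f X n ω ∂P) atTop
      (𝓝 (∫ z, f z ∂((P.map (X 1)).prod (P.map (X 1))))) := by
  rw [tendsto_iff_norm_sub_tendsto_zero]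
  refine squeeze_zero (fun n => norm_nonneg _) (fun n => ?_) hf.tendsto
  have : (∫ ω, uStatistic f X n ω ∂P) - ∫ z, f z ∂((P.map (X 1)).prod (P.map (X 1))) =
      ∫ ω, (uStatistic f X n ω - ∫ z, f z ∂((P.map (X 1)).prod (P.map (X 1)))) ∂P := by
    rw [integral_sub (integrable_uStatistic hf.integrable_pair n) (integrable_const _)]
    simp
  rw [this]
  exact abs_integral_le_integral_abs

/-- Approximation principle: the class of kernels is closed under limits for which the
`U`-statistics are asymptotically close in `L¹`. -/
theorem of_approx (h_prod : Integrable h ((P.map (X 1)).prod (P.map (X 1))))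
    (h_pair : ∀ i j, 1 ≤ i → i < j → Integrable (fun ω => h (X i ω, X j ω)) P)
    (H : ∀ ε > 0, ∃ g, IsLLNKernel X P g ∧
      (∀ᶠ n : ℕ in atTop, ∫ ω, |uStatistic (h - g) X n ω| ∂P ≤ ε) ∧
      ∫ z, |h z - g z| ∂((P.map (X 1)).prod (P.map (X 1))) ≤ ε) :
    IsLLNKernel X P h := by
  refine ⟨h_prod, h_pair, ?_⟩
  rw [Metric.tendsto_nhds]
  intro ε hε
  obtain ⟨g, hg, hU, hI⟩ := H (ε / 4) (by positivity)
  filter_upwards [hU, (Metric.tendsto_nhds.1 hg.tendsto) (ε / 4) (by positivity)] with n h1 h2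
  rw [Real.dist_0_eq_abs] at h2 ⊢
  rw [abs_of_nonneg (integral_nonneg fun ω => abs_nonneg _)] at h2 ⊢
  have hI' : |∫ z, h z ∂((P.map (X 1)).prod (P.map (X 1))) -
      ∫ z, g z ∂((P.map (X 1)).prod (P.map (X 1)))| ≤ ε / 4 := by
    rw [← integral_sub h_prod hg.integrable_prod]
    exact abs_integral_le_integral_abs.trans hI
  set a := ∫ z, h z ∂((P.map (X 1)).prod (P.map (X 1)))
  set b := ∫ z, g z ∂((P.map (X 1)).prod (P.map (X 1)))
  have hsub : ∀ i j, 1 ≤ i → i < j → Integrable (fun ω => (h - g) (X i ω, X j ω)) P :=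
    fun i j hi hj => (h_pair i j hi hj).sub (hg.integrable_pair i j hi hj)
  have i1 := (integrable_uStatistic hsub n).abs
  have i2 : Integrable (fun ω => |uStatistic g X n ω - b|) P :=
    ((integrable_uStatistic hg.integrable_pair n).sub (integrable_const b)).abs
  have i3 : Integrable (fun _ : Ω => |a - b|) P := integrable_const _
  calc ∫ ω, |uStatistic h X n ω - a| ∂P
      ≤ ∫ ω, ((|uStatistic (h - g) X n ω| + |uStatistic g X n ω - b|) + |a - b|) ∂P := by
        refine integral_mono ((integrable_uStatistic h_pair n).sub (integrable_const a)).abs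
          ((i1.add i2).add i3) fun ω => ?_
        simp only [uStatistic_sub]
        have e : uStatistic h X n ω - a = (uStatistic h X n ω - uStatistic g X n ω) +
          (uStatistic g X n ω - b) - (a - b) := by ring
        rw [e]
        exact (abs_sub _ _).trans (by gcongr; exact abs_add_le _ _)
    _ = ∫ ω, |uStatistic (h - g) X n ω| ∂P + ∫ ω, |uStatistic g X n ω - b| ∂P + |a - b| := by
        rw [integral_add (f := fun ω => |uStatistic (h - g) X n ω| + |uStatistic g X n ω - b|)
          (i1.add i2) i3, integral_add i1 i2]
        simp
    _ < ε := by linarith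

/-- Approximation in `L¹` of all the pair laws and of the product law. -/
theorem of_approx_pair (h_prod : Integrable h ((P.map (X 1)).prod (P.map (X 1))))
    (h_pair : ∀ i j, 1 ≤ i → i < j → Integrable (fun ω => h (X i ω, X j ω)) P)
    (H : ∀ ε > 0, ∃ g, IsLLNKernel X P g ∧
      (∀ i j, 1 ≤ i → i < j → ∫ ω, |h (X i ω, X j ω) - g (X i ω, X j ω)| ∂P ≤ ε) ∧
      ∫ z, |h z - g z| ∂((P.map (X 1)).prod (P.map (X 1))) ≤ ε) :
    IsLLNKernel X P h := by
  refine of_approx h_prod h_pair fun ε hε => ?_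
  obtain ⟨g, hg, hU, hI⟩ := H ε hε
  refine ⟨g, hg, Eventually.of_forall fun n => ?_, hI⟩
  exact integral_abs_uStatistic_le
    (fun i j hi hj => (h_pair i j hi hj).sub (hg.integrable_pair i j hi hj)) hε.le hU n

/-- Approximation from above and below: it suffices to bound `|h - g|` pointwise by a kernel `ψ` in
the class whose integral under the product law is small. -/
theorem of_sandwich (h_prod : Integrable h ((P.map (X 1)).prod (P.map (X 1))))
    (h_pair : ∀ i j, 1 ≤ i → i < j → Integrable (fun ω => h (X i ω, X j ω)) P)
    (H : ∀ ε > 0, ∃ g ψ, IsLLNKernel X P g ∧ IsLLNKernel X P ψ ∧ (∀ z, |h z - g z| ≤ ψ z) ∧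
      ∫ z, ψ z ∂((P.map (X 1)).prod (P.map (X 1))) ≤ ε) :
    IsLLNKernel X P h := by
  refine of_approx h_prod h_pair fun ε hε => ?_
  obtain ⟨g, ψ, hg, hψ, hle, hI⟩ := H (ε / 2) (by positivity)
  refine ⟨g, hg, ?_, ?_⟩
  · filter_upwards [hψ.tendsto_integral.eventually_lt_const
      (show _ < ε by linarith)] with n hn
    refine le_trans (integral_mono ?_ (integrable_uStatistic hψ.integrable_pair n)
      fun ω => abs_uStatistic_le hle n ω) hn.le
    exact (integrable_uStatistic
      (fun i j hi hj => (h_pair i j hi hj).sub (hg.integrable_pair i j hi hj)) n).abs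
  · have := integral_mono (h_prod.sub hg.integrable_prod).abs hψ.integrable_prod hle
    simp only [Pi.sub_apply] at this
    linarith

end IsLLNKernel

/-! ### Tensor products -/

/-- Bounded tensor products satisfy the law of large numbers. Writing `a`, `b` for the means of `u`,
`v`, the centred kernel is `(u x - a) * v y + a * (v y - b)`, so that its sum over pairs is
controlled by the centred partial sums of `u` and of `v`. -/
theorem IsStationaryErgodic.isLLNKernel_mul [IsProbabilityMeasure P]
    (hX : IsStationaryErgodic X P) {u v : E → ℝ} (hu : Measurable u) (hv : Measurable v)
    (hu1 : ∀ x, |u x| ≤ 1) (hv1 : ∀ x, |v x| ≤ 1) :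
    IsLLNKernel X P fun z => u z.1 * v z.2 := by
  have : IsProbabilityMeasure (P.map (X 1)) :=
    Measure.isProbabilityMeasure_map (hX.measurable 1).aemeasurable
  have huv : Measurable fun z : E × E => u z.1 * v z.2 :=
    (hu.comp measurable_fst).mul (hv.comp measurable_snd)
  have hb : ∀ z : E × E, ‖u z.1 * v z.2‖ ≤ 1 := fun z => by
    rw [Real.norm_eq_abs, abs_mul]
    exact mul_le_one₀ (hu1 _) (abs_nonneg _) (hv1 _)
  have hpair : ∀ i j, 1 ≤ i → i < j → Integrable (fun ω => u (X i ω) * v (X j ω)) P :=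
    fun i j _ _ => Integrable.of_bound (huv.comp (hX.measurable_pair i j)).aestronglyMeasurable 1
      (Eventually.of_forall fun ω => hb (X i ω, X j ω))
  refine ⟨Integrable.of_bound huv.aestronglyMeasurable 1 (Eventually.of_forall hb), hpair, ?_⟩
  rw [integral_prod_mul]
  set a := ∫ x, u x ∂(P.map (X 1)) with ha
  set b := ∫ x, v x ∂(P.map (X 1)) with hb'
  have ha1 : |a| ≤ 1 := by
    have := norm_integral_le_of_norm_le_const (μ := P.map (X 1)) (f := u) (C := 1)
      (Eventually.of_forall hu1)
    simpa using this
  have hA := hX.integral_abs_sum_isLittleO hu hu1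
  have hB := hX.integral_abs_sum_isLittleO hv hv1
  rw [← ha] at hA
  rw [← hb'] at hB
  set A : ℕ → Ω → ℝ := fun n ω => |∑ i ∈ Finset.Icc 1 n, (u (X i ω) - a)|
  set B : ℕ → Ω → ℝ := fun n ω => |∑ i ∈ Finset.Icc 1 n, (v (X i ω) - b)|
  have hui : ∀ i, Integrable (fun ω => u (X i ω)) P := fun i =>
    Integrable.of_bound (hu.comp (hX.measurable i)).aestronglyMeasurable 1
      (Eventually.of_forall fun ω => hu1 _)
  have hvi : ∀ i, Integrable (fun ω => v (X i ω)) P := fun i =>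
    Integrable.of_bound (hv.comp (hX.measurable i)).aestronglyMeasurable 1
      (Eventually.of_forall fun ω => hv1 _)
  have hAi : ∀ n, Integrable (A n) P := fun n =>
    (integrable_finsetSum _ fun i _ => (hui i).sub (integrable_const a)).abs
  have hBi : ∀ n, Integrable (B n) P := fun n =>
    (integrable_finsetSum _ fun i _ => (hvi i).sub (integrable_const b)).abs
  have hpt : ∀ n ω, |∑ i ∈ Finset.Icc 1 n, ∑ j ∈ Finset.Ioc i n, (u (X i ω) * v (X j ω) - a * b)| ≤
      ∑ k ∈ Finset.range n, A k ω + (∑ k ∈ Finset.range n, B k ω + (n + 1) * B n ω) := by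
    intro n ω
    have e : ∑ i ∈ Finset.Icc 1 n, ∑ j ∈ Finset.Ioc i n, (u (X i ω) * v (X j ω) - a * b) =
        ∑ i ∈ Finset.Icc 1 n, ∑ j ∈ Finset.Ioc i n, (u (X i ω) - a) * v (X j ω) +
        a * ∑ i ∈ Finset.Icc 1 n, ∑ j ∈ Finset.Ioc i n, (v (X j ω) - b) := by
      simp only [Finset.mul_sum, ← Finset.sum_add_distrib]
      refine Finset.sum_congr rfl fun i _ => Finset.sum_congr rfl fun j _ => by ring
    rw [e]
    refine (abs_add_le _ _).trans (add_le_add ?_ ?_)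
    · rw [Finset.sum_Icc_sum_Ioc_eq_sum_range n fun i j => (u (X i ω) - a) * v (X j ω)]
      refine (Finset.abs_sum_le_sum_abs _ _).trans (Finset.sum_le_sum fun k _ => ?_)
      rw [← Finset.sum_mul, abs_mul]
      exact mul_le_of_le_one_right (abs_nonneg _) (hv1 _)
    · rw [abs_mul]
      refine (mul_le_of_le_one_left (abs_nonneg _) ha1).trans ?_
      have e2 : ∀ i ∈ Finset.Icc 1 n, ∑ j ∈ Finset.Ioc i n, (v (X j ω) - b) =
          ∑ j ∈ Finset.Icc 1 n, (v (X j ω) - b) - ∑ j ∈ Finset.Icc 1 i, (v (X j ω) - b) := by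
        intro i hi
        rw [Finset.mem_Icc] at hi
        rw [eq_sub_iff_add_eq', ← Finset.sum_union]
        · refine Finset.sum_congr ?_ fun _ _ => rfl
          ext j; simp only [Finset.mem_union, Finset.mem_Icc, Finset.mem_Ioc]; omega
        · rw [Finset.disjoint_left]
          intro j; simp only [Finset.mem_Icc, Finset.mem_Ioc]; omega
      rw [Finset.sum_congr rfl e2]
      have hBn : 0 ≤ B n ω := abs_nonneg _
      calc |∑ i ∈ Finset.Icc 1 n, (∑ j ∈ Finset.Icc 1 n, (v (X j ω) - b) -
            ∑ j ∈ Finset.Icc 1 i, (v (X j ω) - b))|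
          ≤ ∑ i ∈ Finset.Icc 1 n, (B n ω + B i ω) :=
            (Finset.abs_sum_le_sum_abs _ _).trans (Finset.sum_le_sum fun i _ => abs_sub _ _)
        _ = n * B n ω + ∑ i ∈ Finset.Icc 1 n, B i ω := by
            rw [Finset.sum_add_distrib]; simp
        _ ≤ n * B n ω + ∑ i ∈ Finset.range (n + 1), B i ω := by
            gcongr
            intro i
            simp only [Finset.mem_Icc, Finset.mem_range]; omega
        _ = _ := by rw [Finset.sum_range_succ]; ring
  have hsum : ∀ e : ℕ → ℝ, e =o[atTop] (fun n : ℕ => (n : ℝ)) →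
      (fun n => ∑ k ∈ Finset.range n, e k) =o[atTop] fun n : ℕ => ((n.choose 2 : ℕ) : ℝ) := by
    intro e he
    have hs : (fun n : ℕ => ∑ k ∈ Finset.range n, (k : ℝ)) =
        fun n : ℕ => ((n.choose 2 : ℕ) : ℝ) := by
      funext n
      rw [← Nat.cast_sum, Finset.sum_range_id, Nat.choose_two_right]
    rw [← hs]
    refine he.sum_range (fun n => Nat.cast_nonneg n) ?_
    refine tendsto_atTop_mono' atTop ?_ (tendsto_natCast_atTop_atTop.comp (tendsto_sub_atTop_nat 1))
    filter_upwards [eventually_ge_atTop 1] with n hn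
    exact Finset.single_le_sum (f := fun k : ℕ => (k : ℝ)) (fun k _ => Nat.cast_nonneg k)
      (Finset.mem_range.2 (by omega : n - 1 < n))
  have hlast : (fun n : ℕ => ((n : ℝ) + 1) * ∫ ω, B n ω ∂P) =o[atTop]
      fun n : ℕ => ((n.choose 2 : ℕ) : ℝ) := by
    refine Asymptotics.IsLittleO.trans_isBigO ?_ Nat.sq_isBigO_choose_two
    simp only [sq]
    refine Asymptotics.IsBigO.mul_isLittleO ?_ hB
    refine Asymptotics.IsBigO.of_bound 2 ?_
    filter_upwards [eventually_ge_atTop 1] with n hn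
    have hn' : (1 : ℝ) ≤ n := by exact_mod_cast hn
    rw [Real.norm_of_nonneg (by positivity), Real.norm_of_nonneg (by positivity)]
    linarith
  have htot := ((hsum _ hA).add ((hsum _ hB).add hlast)).tendsto_div_nhds_zero
  refine squeeze_zero' (Eventually.of_forall fun n => integral_nonneg fun ω => abs_nonneg _) ?_ htot
  filter_upwards [eventually_ge_atTop 2] with n hn
  have hc : (0 : ℝ) < (n.choose 2 : ℕ) := by exact_mod_cast Nat.choose_pos hn
  have iA : Integrable (fun ω => ∑ k ∈ Finset.range n, A k ω) P :=
    integrable_finsetSum _ fun k _ => hAi k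
  have iB : Integrable (fun ω => ∑ k ∈ Finset.range n, B k ω) P :=
    integrable_finsetSum _ fun k _ => hBi k
  have iC : Integrable (fun ω => ((n : ℝ) + 1) * B n ω) P := (hBi n).const_mul _
  have iBC : Integrable (fun ω => ∑ k ∈ Finset.range n, B k ω + ((n : ℝ) + 1) * B n ω) P :=
    iB.add iC
  rw [le_div_iff₀ hc, ← integral_mul_const]
  calc ∫ ω, |uStatistic (fun z => u z.1 * v z.2) X n ω - a * b| * ((n.choose 2 : ℕ) : ℝ) ∂P
      ≤ ∫ ω, (∑ k ∈ Finset.range n, A k ω +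
          (∑ k ∈ Finset.range n, B k ω + (n + 1) * B n ω)) ∂P := by
        refine integral_mono (((integrable_uStatistic hpair n).sub
          (integrable_const (a * b))).abs.mul_const _) (iA.add iBC) fun ω => ?_
        refine le_trans (le_of_eq ?_) (hpt n ω)
        simp only [Finset.sum_sub_distrib, Nat.sum_Icc_sum_Ioc_const]
        rw [← abs_of_pos hc, ← abs_mul, abs_of_pos hc, sub_mul, uStatistic]
        congr 1
        field_simp
    _ = _ := by
        rw [integral_add iA iBC, integral_add iB iC, integral_const_mul,
          integral_finsetSum _ fun k _ => hAi k, integral_finsetSum _ fun k _ => hBi k]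

end Kernel

/-! ### Simple functions over rectangles and almost everywhere continuous kernels -/

section Rectangle

variable {Ω E : Type*} [MeasurableSpace Ω] [MeasurableSpace E] {P : Measure Ω}
  {X : ℕ → Ω → E}

/-- The multiplicative monoid of indicator functions of measurable rectangles. -/
def rectangleIndicators (E : Type*) [MeasurableSpace E] : Submonoid (E × E → ℝ) where
  carrier := {f | ∃ s t : Set E, MeasurableSet s ∧ MeasurableSet t ∧
    f = fun z => s.indicator 1 z.1 * t.indicator 1 z.2}
  mul_mem' := by
    rintro _ _ ⟨s, t, hs, ht, rfl⟩ ⟨s', t', hs', ht', rfl⟩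
    refine ⟨s ∩ s', t ∩ t', hs.inter hs', ht.inter ht', ?_⟩
    funext z
    simp only [Pi.mul_apply, Set.inter_indicator_one]
    ring
  one_mem' := ⟨Set.univ, Set.univ, .univ, .univ, by funext z; simp⟩

/-- The algebra of simple functions over measurable rectangles. -/
noncomputable def rectangleAlgebra (E : Type*) [MeasurableSpace E] :
    Subalgebra ℝ (E × E → ℝ) :=
  Algebra.adjoin ℝ (rectangleIndicators E : Set (E × E → ℝ))

theorem indicator_mem_rectangleAlgebra {s t : Set E} (hs : MeasurableSet s)
    (ht : MeasurableSet t) :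
    (fun z => s.indicator 1 z.1 * t.indicator 1 z.2) ∈ rectangleAlgebra E :=
  Algebra.subset_adjoin ⟨s, t, hs, ht, rfl⟩

/-- Products of rectangle indicators are rectangle indicators, so the algebra is their linear span;
this is why the linear class of kernels obeying the law of large numbers contains it. -/
theorem IsStationaryErgodic.isLLNKernel_of_mem_rectangleAlgebra [IsProbabilityMeasure P]
    (hX : IsStationaryErgodic X P) {f : E × E → ℝ} (hf : f ∈ rectangleAlgebra E) :
    IsLLNKernel X P f := by
  have hind : ∀ s t : Set E, MeasurableSet s → MeasurableSet t →
      IsLLNKernel X P fun z => s.indicator 1 z.1 * t.indicator 1 z.2 := by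
    have h1 : ∀ (s : Set E) (x : E), |s.indicator (1 : E → ℝ) x| ≤ 1 := fun s x => by
      by_cases hx : x ∈ s <;> simp [hx]
    exact fun s t hs ht => hX.isLLNKernel_mul (measurable_one.indicator hs)
      (measurable_one.indicator ht) (h1 s) (h1 t)
  rw [rectangleAlgebra, ← Subalgebra.mem_toSubmodule, Algebra.adjoin_eq_span,
    Submonoid.closure_eq] at hf
  induction hf using Submodule.span_induction with
  | mem f hf =>
    obtain ⟨s, t, hs, ht, rfl⟩ := hf
    exact hind s t hs ht
  | zero => simpa using (hind ∅ ∅ .empty .empty).smul 0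
  | add f g _ _ hf hg => exact hf.add hg
  | smul c f _ hf => exact hf.smul c

/-- Along a sequence of rectangles on each of which `h` has oscillation at most `ε`, the function
`h` is approximated by a simple function on the union of the first `n` rectangles; `χ` is the
indicator function of the complement of that union. -/
theorem exists_mem_rectangleAlgebra_approx {h : E × E → ℝ} {ε : ℝ} {s t : ℕ → Set E} {c : ℕ → ℝ}
    (hs : ∀ k, MeasurableSet (s k)) (ht : ∀ k, MeasurableSet (t k))
    (hc : ∀ k, ∀ z ∈ s k ×ˢ t k, |h z - c k| ≤ ε) (n : ℕ) :
    ∃ g ∈ rectangleAlgebra E, ∃ χ ∈ rectangleAlgebra E,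
      (∀ z ∈ ⋃ k < n, s k ×ˢ t k, |h z - g z| ≤ ε) ∧
      (∀ z ∉ ⋃ k < n, s k ×ˢ t k, g z = 0) ∧
      χ = (⋃ k < n, s k ×ˢ t k)ᶜ.indicator 1 := by
  induction n with
  | zero => exact ⟨0, zero_mem _, 1, one_mem _, by simp, by simp, by simp⟩
  | succ n ih =>
    obtain ⟨g, hg, χ, hχ, h1, h2, h3⟩ := ih
    set W := ⋃ k < n, s k ×ˢ t k
    have hU : (⋃ k < n + 1, s k ×ˢ t k) = W ∪ s n ×ˢ t n := Set.biUnion_lt_succ _ _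
    let r : E × E → ℝ := fun z => (s n).indicator 1 z.1 * (t n).indicator 1 z.2
    have hr : r ∈ rectangleAlgebra E := indicator_mem_rectangleAlgebra (hs n) (ht n)
    have hr1 : ∀ z ∈ s n ×ˢ t n, r z = 1 := fun z hz => by
      simp [r, hz.1, hz.2]
    have hr0 : ∀ z ∉ s n ×ˢ t n, r z = 0 := fun z hz => by
      rw [Set.mem_prod, not_and_or] at hz
      rcases hz with hz | hz <;> simp [r, hz]
    have hχ1 : ∀ z ∉ W, χ z = 1 := fun z hz => by simp [h3, hz]
    have hχ0 : ∀ z ∈ W, χ z = 0 := fun z hz => by simp [h3, hz]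
    rw [hU]
    refine ⟨g + c n • (χ * r), add_mem hg (Subalgebra.smul_mem _ (mul_mem hχ hr) _),
      χ * (1 - r), mul_mem hχ (sub_mem (one_mem _) hr), fun z hz => ?_, fun z hz => ?_, ?_⟩
    · by_cases hzW : z ∈ W
      · simpa [hχ0 z hzW] using h1 z hzW
      · have hz' : z ∈ s n ×ˢ t n := hz.resolve_left hzW
        simpa [hχ1 z hzW, hr1 z hz', h2 z hzW] using hc n z hz'
    · rw [Set.mem_union, not_or] at hz
      simp [h2 z hz.1, hr0 z hz.2]
    · funext z
      by_cases hzW : z ∈ W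
      · simp [hχ0 z hzW, hzW]
      · by_cases hz' : z ∈ s n ×ˢ t n
        · have : z ∉ (W ∪ s n ×ˢ t n)ᶜ := fun hz => hz (Or.inr hz')
          rw [Set.indicator_of_notMem this]
          simp [hr1 z hz']
        · have : z ∈ (W ∪ s n ×ˢ t n)ᶜ := fun hz => hz.elim hzW hz'
          rw [Set.indicator_of_mem this]
          simp [hχ1 z hzW, hr0 z hz']

/-- In a second countable space the continuity points of `h` are covered by countably many open
rectangles on which `h` has small oscillation. -/
theorem exists_open_rectangles_cover {E : Type*} [TopologicalSpace E] [SecondCountableTopology E]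
    (h : E × E → ℝ) {ε : ℝ} (hε : 0 < ε) :
    ∃ (s t : ℕ → Set E) (c : ℕ → ℝ), (∀ k, IsOpen (s k)) ∧ (∀ k, IsOpen (t k)) ∧
      (∀ k, ∀ z ∈ s k ×ˢ t k, |h z - c k| ≤ ε) ∧
      ∀ z, ContinuousAt h z → z ∈ ⋃ k, s k ×ˢ t k := by
  let b := TopologicalSpace.countableBasis E
  have hb := TopologicalSpace.isBasis_countableBasis E
  let S : Set (Set E × Set E) := {p | p ∈ insert (∅, ∅) (b ×ˢ b) ∧
    ∃ c : ℝ, ∀ z ∈ p.1 ×ˢ p.2, |h z - c| ≤ ε}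
  have hScount : S.Countable := Set.Countable.mono (fun p hp => hp.1)
    (((TopologicalSpace.countable_countableBasis E).prod
      (TopologicalSpace.countable_countableBasis E)).insert _)
  have hSne : S.Nonempty := ⟨(∅, ∅), Set.mem_insert _ _, 0, by simp⟩
  obtain ⟨p, hp⟩ := hScount.exists_eq_range hSne
  have hpS : ∀ k, p k ∈ S := fun k => hp ▸ Set.mem_range_self k
  have hopen : ∀ k, IsOpen (p k).1 ∧ IsOpen (p k).2 := by
    intro k
    rcases (hpS k).1 with h0 | h0
    · rw [h0]; exact ⟨isOpen_empty, isOpen_empty⟩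
    · exact ⟨hb.isOpen h0.1, hb.isOpen h0.2⟩
  choose c hc using fun k => (hpS k).2
  refine ⟨fun k => (p k).1, fun k => (p k).2, c, fun k => (hopen k).1, fun k => (hopen k).2,
    hc, fun z hz => ?_⟩
  have hnhds : {w | |h w - h z| ≤ ε} ∈ 𝓝 z := by
    filter_upwards [Metric.tendsto_nhds.1 hz ε hε] with w hw
    exact (Real.dist_eq (h w) (h z) ▸ hw).le
  obtain ⟨u, ⟨hu1, hu2⟩, hu3⟩ := ((hb.nhds_hasBasis (a := z.1)).prod_nhds
    (hb.nhds_hasBasis (a := z.2))).mem_iff.1 hnhds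
  have hmem : u ∈ S := ⟨Set.mem_insert_of_mem _ ⟨hu1.1, hu2.1⟩, h z, fun w hw => hu3 hw⟩
  rw [hp] at hmem
  obtain ⟨k, rfl⟩ := hmem
  exact Set.mem_iUnion.2 ⟨k, hu1.2, hu2.2⟩

/-- Bounded kernels that are almost everywhere continuous: finitely many rectangles of small
oscillation cover everything up to a set of small measure, and the `U`-statistic of the indicator
function of the uncovered set obeys the law of large numbers as well. -/
theorem IsStationaryErgodic.isLLNKernel_of_ae_continuousAt [TopologicalSpace E]
    [SecondCountableTopology E] [OpensMeasurableSpace E] [IsProbabilityMeasure P]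
    (hX : IsStationaryErgodic X P) {h : E × E → ℝ} (h_meas : Measurable h) {K : ℝ}
    (hK : ∀ z, |h z| ≤ K)
    (hcont : ∀ᵐ z ∂((P.map (X 1)).prod (P.map (X 1))), ContinuousAt h z) :
    IsLLNKernel X P h := by
  have : IsProbabilityMeasure (P.map (X 1)) :=
    Measure.isProbabilityMeasure_map (hX.measurable 1).aemeasurable
  set Q := (P.map (X 1)).prod (P.map (X 1))
  refine IsLLNKernel.of_sandwich
    (Integrable.of_bound h_meas.aestronglyMeasurable K (Eventually.of_forall hK))
    (fun i j _ _ => Integrable.of_bound (h_meas.comp (hX.measurable_pair i j)).aestronglyMeasurable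
      K (Eventually.of_forall fun ω => hK (X i ω, X j ω))) fun ε hε => ?_
  obtain ⟨s, t, c, hs, ht, hc, hcov⟩ := exists_open_rectangles_cover h (half_pos hε)
  have hmR : ∀ k, MeasurableSet (s k ×ˢ t k) := fun k =>
    (hs k).measurableSet.prod (ht k).measurableSet
  have hmU : ∀ n, MeasurableSet (⋃ k < n, s k ×ˢ t k) := fun n =>
    .iUnion fun k => .iUnion fun _ => hmR k
  have hlim : Tendsto (fun n : ℕ => Q (⋃ k < n, s k ×ˢ t k)ᶜ) atTop (𝓝 0) := by
    have hinter : Q (⋂ n : ℕ, (⋃ k < n, s k ×ˢ t k)ᶜ) = 0 := by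
      refine measure_mono_null (fun z hz => ?_) hcont
      intro hz'
      obtain ⟨k, hk⟩ := Set.mem_iUnion.1 (hcov z hz')
      exact Set.mem_iInter.1 hz (k + 1) (Set.mem_iUnion₂.2 ⟨k, k.lt_succ_self, hk⟩)
    rw [← hinter]
    refine tendsto_measure_iInter_atTop (fun n => (hmU n).compl.nullMeasurableSet)
      (fun m n hmn => Set.compl_subset_compl.2 ?_) ⟨0, measure_ne_top _ _⟩
    exact Set.biUnion_subset_biUnion_left fun k (hk : k < m) => lt_of_lt_of_le hk hmn
  have hlim' := (ENNReal.tendsto_toReal ENNReal.zero_ne_top).comp hlim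
  have hKlim := hlim'.const_mul K
  simp only [ENNReal.toReal_zero, mul_zero] at hKlim
  obtain ⟨n, hn⟩ := (hKlim.eventually_lt_const (half_pos hε)).exists
  obtain ⟨g, hg, χ, hχ, h1, h2, h3⟩ := exists_mem_rectangleAlgebra_approx
    (fun k => (hs k).measurableSet) (fun k => (ht k).measurableSet) hc n
  have hψ : (ε / 2) • (1 : E × E → ℝ) + K • χ ∈ rectangleAlgebra E :=
    add_mem (Subalgebra.smul_mem _ (one_mem _) _) (Subalgebra.smul_mem _ hχ _)
  refine ⟨g, _, hX.isLLNKernel_of_mem_rectangleAlgebra hg,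
    hX.isLLNKernel_of_mem_rectangleAlgebra hψ, fun z => ?_, ?_⟩
  · by_cases hz : z ∈ ⋃ k < n, s k ×ˢ t k
    · have hχz : χ z = 0 := by rw [h3, Set.indicator_of_notMem (Set.notMem_compl_iff.2 hz)]
      simpa [hχz] using h1 z hz
    · have hχz : χ z = 1 := by rw [h3, Set.indicator_of_mem (show z ∈ _ᶜ from hz)]; rfl
      have := hK z
      simp only [h2 z hz, sub_zero, Pi.add_apply, Pi.smul_apply, Pi.one_apply, smul_eq_mul, hχz]
      linarith
  · have hχi : ∫ z, χ z ∂Q = (Q (⋃ k < n, s k ×ˢ t k)ᶜ).toReal := by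
      rw [h3, integral_indicator_one (hmU n).compl]; rfl
    have hχint : Integrable χ Q := (hX.isLLNKernel_of_mem_rectangleAlgebra hχ).integrable_prod
    simp only [Pi.add_apply, Pi.smul_apply, Pi.one_apply, smul_eq_mul, mul_one]
    rw [integral_add (integrable_const _) (hχint.const_mul K), integral_const_mul, hχi]
    simp only [Function.comp] at hn
    simp only [integral_const, probReal_univ, one_smul]
    linarith

end Rectangle

/-! ### Truncation of unbounded kernels -/

/-- The truncation of the real number `x` to the interval `[-K, K]`. -/
noncomputable def clamp (K x : ℝ) : ℝ := max (-K) (min K x)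

theorem continuous_clamp (K : ℝ) : Continuous (clamp K) :=
  continuous_const.max (continuous_const.min continuous_id)

theorem abs_clamp_le {K : ℝ} (hK : 0 ≤ K) (x : ℝ) : |clamp K x| ≤ K :=
  abs_le.2 ⟨le_max_left _ _, max_le (by linarith) (min_le_left _ _)⟩

theorem clamp_of_abs_le {K x : ℝ} (h : |x| ≤ K) : clamp K x = x := by
  rw [clamp, min_eq_right (abs_le.1 h).2, max_eq_right (abs_le.1 h).1]

theorem abs_clamp_le_abs {K : ℝ} (hK : 0 ≤ K) (x : ℝ) : |clamp K x| ≤ |x| := by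
  rcases le_total |x| K with h | h
  · rw [clamp_of_abs_le h]
  · exact (abs_clamp_le hK x).trans h

theorem abs_sub_clamp_le_abs {K : ℝ} (hK : 0 ≤ K) (x : ℝ) : |x - clamp K x| ≤ |x| := by
  rw [clamp]
  rcases abs_cases x with ⟨h1, h2⟩ | ⟨h1, h2⟩ <;> rw [h1, abs_le] <;>
  rcases min_cases K x with ⟨h3, h4⟩ | ⟨h3, h4⟩ <;> rw [h3] <;>
  constructor <;>
  first
  | (rcases max_cases (-K) K with ⟨h5, h6⟩ | ⟨h5, h6⟩ <;> rw [h5] <;> linarith)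
  | (rcases max_cases (-K) x with ⟨h5, h6⟩ | ⟨h5, h6⟩ <;> rw [h5] <;> linarith)

theorem tendsto_clamp (x : ℝ) : Tendsto (fun n : ℕ => clamp n x) atTop (𝓝 x) := by
  refine tendsto_const_nhds.congr' ?_
  filter_upwards [eventually_ge_atTop ⌈|x|⌉₊] with n hn
  exact (clamp_of_abs_le (Nat.ceil_le.1 hn)).symm

section Truncation

variable {Ω E : Type*} [MeasurableSpace Ω] [MeasurableSpace E] {P : Measure Ω}
  {X : ℕ → Ω → E}

theorem IsStationaryErgodic.map_pair_eq (hX : IsStationaryErgodic X P) {i j : ℕ} (hi : 1 ≤ i)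
    (hij : i < j) :
    P.map (fun ω => (X i ω, X j ω)) = P.map (fun ω => (X 1 ω, X (j - i + 1) ω)) := by
  have := hX.map_pair_add 1 (j - i + 1) (i - 1)
  rwa [show 1 + (i - 1) = i by omega, show j - i + 1 + (i - 1) = j by omega] at this

theorem IsStationaryErgodic.integral_pair_eq (hX : IsStationaryErgodic X P) {φ : E × E → ℝ}
    (hφ : Measurable φ) {i j : ℕ} (hi : 1 ≤ i) (hij : i < j) :
    ∫ ω, φ (X i ω, X j ω) ∂P = ∫ ω, φ (X 1 ω, X (j - i + 1) ω) ∂P := by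
  have h1 := integral_map (hX.measurable_pair i j).aemeasurable (μ := P) hφ.aestronglyMeasurable
  have h2 := integral_map (hX.measurable_pair 1 (j - i + 1)).aemeasurable (μ := P)
    hφ.aestronglyMeasurable
  rw [← h1, ← h2, hX.map_pair_eq hi hij]

variable {h : E × E → ℝ}

theorem IsStationaryErgodic.integrable_pair (hX : IsStationaryErgodic X P) (h_meas : Measurable h)
    (h_ui : UniformIntegrable (fun (j : {j : ℕ // 1 ≤ j}) ω => h (X 1 ω, X j ω)) 1 P)
    (i j : ℕ) (hi : 1 ≤ i) (hij : i < j) : Integrable (fun ω => h (X i ω, X j ω)) P := by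
  have h1 : Integrable (fun ω => h (X 1 ω, X (j - i + 1) ω)) P :=
    memLp_one_iff_integrable.1 (h_ui.memLp ⟨j - i + 1, by omega⟩)
  have e1 := integrable_map_measure (μ := P) h_meas.aestronglyMeasurable
    (hX.measurable_pair 1 (j - i + 1)).aemeasurable
  have e2 := integrable_map_measure (μ := P) h_meas.aestronglyMeasurable
    (hX.measurable_pair i j).aemeasurable
  rw [← hX.map_pair_eq hi hij] at e1
  exact e2.1 (e1.2 h1)

/-- Uniform integrability bounds the `L¹` norms along all pairs. -/
theorem IsStationaryErgodic.exists_integral_abs_pair_le (hX : IsStationaryErgodic X P)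
    (h_meas : Measurable h)
    (h_ui : UniformIntegrable (fun (j : {j : ℕ // 1 ≤ j}) ω => h (X 1 ω, X j ω)) 1 P) :
    ∃ C : ℝ, 0 ≤ C ∧ ∀ i j, 1 ≤ i → i < j → ∫ ω, |h (X i ω, X j ω)| ∂P ≤ C := by
  obtain ⟨-, -, C, hC⟩ := h_ui
  refine ⟨C, C.2, fun i j hi hij => ?_⟩
  rw [hX.integral_pair_eq (φ := fun z => |h z|) h_meas.norm hi hij]
  have := hC ⟨j - i + 1, by omega⟩
  rw [eLpNorm_one_eq_lintegral_enorm] at this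
  have h2 := integral_norm_eq_lintegral_enorm (μ := P)
    (h_meas.comp (hX.measurable_pair 1 (j - i + 1))).aestronglyMeasurable
  simp only [Real.norm_eq_abs, Function.comp] at h2
  rw [h2]
  exact ENNReal.toReal_le_coe_of_le_coe this

/-- Uniform integrability makes truncation errors small along all pairs simultaneously. -/
theorem IsStationaryErgodic.exists_integral_abs_sub_clamp_le (hX : IsStationaryErgodic X P)
    (h_meas : Measurable h)
    (h_ui : UniformIntegrable (fun (j : {j : ℕ // 1 ≤ j}) ω => h (X 1 ω, X j ω)) 1 P)
    {ε : ℝ} (hε : 0 < ε) :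
    ∃ C : ℝ, 0 ≤ C ∧ ∀ K, C ≤ K → ∀ i j, 1 ≤ i → i < j →
      ∫ ω, |h (X i ω, X j ω) - clamp K (h (X i ω, X j ω))| ∂P ≤ ε := by
  obtain ⟨C, hC⟩ := h_ui.spec one_ne_zero ENNReal.one_ne_top hε
  refine ⟨C, C.2, fun K hK i j hi hij => ?_⟩
  have hK0 : (0 : ℝ) ≤ K := C.2.trans hK
  have hcm : Measurable fun z => h z - clamp K (h z) :=
    h_meas.sub ((continuous_clamp K).measurable.comp h_meas)
  rw [hX.integral_pair_eq (φ := fun z => |h z - clamp K (h z)|) hcm.norm hi hij]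
  have := hC ⟨j - i + 1, by omega⟩
  rw [eLpNorm_one_eq_lintegral_enorm] at this
  have h2 := integral_norm_eq_lintegral_enorm (μ := P)
    (hcm.comp (hX.measurable_pair 1 (j - i + 1))).aestronglyMeasurable
  simp only [Real.norm_eq_abs, Function.comp] at h2
  rw [h2]
  refine ENNReal.toReal_le_of_le_ofReal hε.le (le_trans (lintegral_mono fun ω => ?_) this)
  -- The truncation error vanishes where `|h| ≤ K` and is bounded by `|h|` everywhere.
  simp only
  set x := h (X 1 ω, X (j - i + 1) ω) with hx
  by_cases hxK : |x| ≤ K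
  · rw [clamp_of_abs_le hxK]; simp
  · have hmem : ω ∈ {ω | C ≤ ‖h (X 1 ω, X (j - i + 1) ω)‖₊} := by
      change (C : ℝ) ≤ |x|
      linarith
    rw [Set.indicator_of_mem hmem, ← hx]
    rw [enorm_le_iff_norm_le]
    exact abs_sub_clamp_le_abs hK0 x

variable [IsProbabilityMeasure P]

/-- If all truncations of a uniformly integrable and `F × F`-integrable kernel obey the law of large
numbers, then so does the kernel. -/
theorem IsStationaryErgodic.isLLNKernel_of_clamp (hX : IsStationaryErgodic X P)
    (h_meas : Measurable h)
    (h_ui : UniformIntegrable (fun (j : {j : ℕ // 1 ≤ j}) ω => h (X 1 ω, X j ω)) 1 P)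
    (h_prod : Integrable h ((P.map (X 1)).prod (P.map (X 1))))
    (H : ∀ n : ℕ, IsLLNKernel X P fun z => clamp n (h z)) : IsLLNKernel X P h := by
  refine IsLLNKernel.of_approx_pair h_prod (hX.integrable_pair h_meas h_ui) fun ε hε => ?_
  obtain ⟨C, hC0, hC⟩ := hX.exists_integral_abs_sub_clamp_le h_meas h_ui hε
  have hlim : Tendsto (fun n : ℕ => ∫ z, |h z - clamp n (h z)| ∂((P.map (X 1)).prod (P.map (X 1))))
      atTop (𝓝 (∫ _z, (0 : ℝ) ∂((P.map (X 1)).prod (P.map (X 1))))) := by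
    refine tendsto_integral_of_dominated_convergence (fun z => |h z|) (fun n => ?_) h_prod.abs
      (fun n => Eventually.of_forall fun z => ?_) (Eventually.of_forall fun z => ?_)
    · exact (h_meas.sub ((continuous_clamp n).measurable.comp h_meas)).norm.aestronglyMeasurable
    · rw [Real.norm_eq_abs, abs_abs]
      exact abs_sub_clamp_le_abs n.cast_nonneg _
    · simpa using ((tendsto_const_nhds (x := h z)).sub (tendsto_clamp (h z))).abs
  rw [integral_zero] at hlim
  obtain ⟨n, hn, hnC⟩ := ((hlim.eventually_lt_const hε).and
    (eventually_ge_atTop ⌈C⌉₊)).exists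
  exact ⟨_, H n, hC n (Nat.ceil_le.1 hnC), hn.le⟩

/-! ### Almost everywhere continuous kernels -/

/-- A uniformly integrable, almost everywhere continuous kernel is integrable under the product law:
its truncations obey the law of large numbers, hence their `L¹` norms under the product law are
limits of means of `U`-statistics, which uniform integrability bounds. -/
theorem IsStationaryErgodic.integrable_prod_of_ae_continuousAt [TopologicalSpace E]
    [SecondCountableTopology E] [OpensMeasurableSpace E] (hX : IsStationaryErgodic X P)
    (h_meas : Measurable h)
    (h_ui : UniformIntegrable (fun (j : {j : ℕ // 1 ≤ j}) ω => h (X 1 ω, X j ω)) 1 P)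
    (hcont : ∀ᵐ z ∂((P.map (X 1)).prod (P.map (X 1))), ContinuousAt h z) :
    Integrable h ((P.map (X 1)).prod (P.map (X 1))) := by
  obtain ⟨C, hC0, hC⟩ := hX.exists_integral_abs_pair_le h_meas h_ui
  have hcm : ∀ n : ℕ, Measurable fun z => |clamp n (h z)| := fun n =>
    ((continuous_clamp n).measurable.comp h_meas).norm
  have hlln : ∀ n : ℕ, IsLLNKernel X P fun z => |clamp n (h z)| := by
    intro n
    refine hX.isLLNKernel_of_ae_continuousAt (hcm n) (K := n) (fun z => ?_) ?_
    · rw [abs_abs]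
      exact abs_clamp_le n.cast_nonneg _
    · filter_upwards [hcont] with z hz
      exact ((continuous_clamp n).abs.continuousAt).comp hz
  have hbound : ∀ n : ℕ, ∫ z, |clamp n (h z)| ∂((P.map (X 1)).prod (P.map (X 1))) ≤ C := by
    intro n
    refine le_of_tendsto (hlln n).tendsto_integral (Eventually.of_forall fun m => ?_)
    refine le_trans ((le_abs_self _).trans abs_integral_le_integral_abs)
      (integral_abs_uStatistic_le (hlln n).integrable_pair hC0 (fun i j hi hij => ?_) m)
    refine le_trans (integral_mono ((hlln n).integrable_pair i j hi hij).abs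
      (hX.integrable_pair h_meas h_ui i j hi hij).abs fun ω => ?_) (hC i j hi hij)
    simp only [abs_abs]
    exact abs_clamp_le_abs n.cast_nonneg _
  -- Fatou's lemma along the truncations.
  refine ⟨h_meas.aestronglyMeasurable, lt_of_le_of_lt ?_ (ENNReal.ofReal_lt_top (r := C))⟩
  calc ∫⁻ z, ‖h z‖ₑ ∂((P.map (X 1)).prod (P.map (X 1)))
      = ∫⁻ z, liminf (fun n : ℕ => ‖clamp n (h z)‖ₑ) atTop ∂((P.map (X 1)).prod (P.map (X 1))) :=
        lintegral_congr fun z => (tendsto_clamp (h z)).enorm.liminf_eq.symm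
    _ ≤ liminf (fun n : ℕ => ∫⁻ z, ‖clamp n (h z)‖ₑ ∂((P.map (X 1)).prod (P.map (X 1)))) atTop :=
        lintegral_liminf_le fun n => ((continuous_clamp n).measurable.comp h_meas).enorm
    _ ≤ ENNReal.ofReal C := ?_
  refine liminf_le_of_le (by isBoundedDefault) fun b hb => ?_
  obtain ⟨n, hn⟩ := hb.exists
  refine hn.trans ?_
  have e := ofReal_integral_norm_eq_lintegral_enorm (hlln n).integrable_prod
  simp only [← Real.norm_eq_abs, norm_norm, enorm_norm] at e
  rw [← e]
  exact ENNReal.ofReal_le_ofReal (hbound n)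

theorem IsStationaryErgodic.isLLNKernel_of_ae_continuousAt_of_uniformIntegrable [TopologicalSpace E]
    [SecondCountableTopology E] [OpensMeasurableSpace E] (hX : IsStationaryErgodic X P)
    (h_meas : Measurable h)
    (h_ui : UniformIntegrable (fun (j : {j : ℕ // 1 ≤ j}) ω => h (X 1 ω, X j ω)) 1 P)
    (hcont : ∀ᵐ z ∂((P.map (X 1)).prod (P.map (X 1))), ContinuousAt h z) :
    IsLLNKernel X P h := by
  refine hX.isLLNKernel_of_clamp h_meas h_ui
    (hX.integrable_prod_of_ae_continuousAt h_meas h_ui hcont) fun n => ?_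
  refine hX.isLLNKernel_of_ae_continuousAt ((continuous_clamp n).measurable.comp h_meas) (K := n)
    (fun z => abs_clamp_le n.cast_nonneg _) ?_
  filter_upwards [hcont] with z hz
  exact (continuous_clamp n).continuousAt.comp hz

end Truncation

/-! ### Kernels of processes with bounded densities -/

section Density

variable {Ω E : Type*} [MeasurableSpace Ω] {P : Measure Ω} [IsProbabilityMeasure P]
  [NormedAddCommGroup E] [ProperSpace E] [MeasurableSpace E] [BorelSpace E] {X : ℕ → Ω → E}
  {ν : Measure E} [IsFiniteMeasureOnCompacts ν] {h : E × E → ℝ}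

theorem integral_abs_le_of_le_smul {α : Type*} [MeasurableSpace α] {Q μ : Measure α} {M : ℝ≥0}
    (hQ : Q ≤ M • μ) {f : α → ℝ} (hf : Integrable f μ) :
    ∫ z, |f z| ∂Q ≤ M * ∫ z, |f z| ∂μ := by
  refine (integral_mono_measure hQ (Eventually.of_forall fun z => abs_nonneg _)
    (hf.abs.smul_measure_nnreal)).trans_eq ?_
  rw [integral_smul_nnreal_measure]
  rfl

/-- Bounded kernels integrable with respect to the reference measure are approximated in `L¹` by
compactly supported continuous kernels, uniformly over all pair laws by the density bound. -/
theorem IsStationaryErgodic.isLLNKernel_of_le_smul_of_integrable (hX : IsStationaryErgodic X P)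
    (h_meas : Measurable h) {K : ℝ} (hK : ∀ z, |h z| ≤ K) (h_int : Integrable h (ν.prod ν))
    {M : ℝ≥0} (hM : ∀ i j, 1 ≤ i → i < j → P.map (fun ω => (X i ω, X j ω)) ≤ M • ν.prod ν)
    (hM' : (P.map (X 1)).prod (P.map (X 1)) ≤ M • ν.prod ν) : IsLLNKernel X P h := by
  have : IsProbabilityMeasure (P.map (X 1)) :=
    Measure.isProbabilityMeasure_map (hX.measurable 1).aemeasurable
  refine IsLLNKernel.of_approx_pair
    (Integrable.of_bound h_meas.aestronglyMeasurable K (Eventually.of_forall hK))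
    (fun i j _ _ => Integrable.of_bound (h_meas.comp (hX.measurable_pair i j)).aestronglyMeasurable
      K (Eventually.of_forall fun ω => hK (X i ω, X j ω))) fun ε hε => ?_
  obtain ⟨g, hgs, hg, hgc, hgi⟩ := h_int.exists_hasCompactSupport_integral_sub_le
    (ε := ε / (M + 1)) (by positivity)
  obtain ⟨L, hL⟩ := hgs.exists_bound_of_continuous hgc
  have hgM : ∀ Q : Measure (E × E), Q ≤ M • ν.prod ν → ∫ z, |h z - g z| ∂Q ≤ ε := by
    intro Q hQ
    refine (integral_abs_le_of_le_smul hQ (h_int.sub hgi)).trans ?_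
    have hM0 : (0 : ℝ) ≤ M := M.2
    calc (M : ℝ) * ∫ z, |(h - g) z| ∂(ν.prod ν) ≤ M * (ε / (M + 1)) := by
          gcongr
          exact hg
      _ ≤ ε := by
          rw [← mul_div_assoc, div_le_iff₀ (by positivity)]
          nlinarith
  refine ⟨g, hX.isLLNKernel_of_ae_continuousAt hgc.measurable hL
    (Eventually.of_forall fun z => hgc.continuousAt), fun i j hi hij => ?_, hgM _ hM'⟩
  have := hgM _ (hM i j hi hij)
  rwa [integral_map (f := fun z => |h z - g z|) (hX.measurable_pair i j).aemeasurable
    (h_meas.sub hgc.measurable).norm.aestronglyMeasurable] at this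

/-- Bounded kernels are approximated by their restrictions to large balls, uniformly over all
measures on the product whose two marginals are the law of the process. -/
theorem IsStationaryErgodic.isLLNKernel_of_le_smul_of_bounded (hX : IsStationaryErgodic X P)
    (h_meas : Measurable h) {K : ℝ} (hK : ∀ z, |h z| ≤ K)
    {M : ℝ≥0} (hM : ∀ i j, 1 ≤ i → i < j → P.map (fun ω => (X i ω, X j ω)) ≤ M • ν.prod ν)
    (hM' : (P.map (X 1)).prod (P.map (X 1)) ≤ M • ν.prod ν) : IsLLNKernel X P h := by
  set F := P.map (X 1) with hF
  have : IsProbabilityMeasure F :=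
    Measure.isProbabilityMeasure_map (hX.measurable 1).aemeasurable
  have hK0 : 0 ≤ K := (abs_nonneg _).trans (hK (0, 0))
  refine IsLLNKernel.of_approx_pair
    (Integrable.of_bound h_meas.aestronglyMeasurable K (Eventually.of_forall hK))
    (fun i j _ _ => Integrable.of_bound (h_meas.comp (hX.measurable_pair i j)).aestronglyMeasurable
      K (Eventually.of_forall fun ω => hK (X i ω, X j ω))) fun ε hε => ?_
  have hball : ∀ R : ℝ, MeasurableSet (Metric.closedBall (0 : E) R) := fun R =>
    measurableSet_closedBall
  have hball' : ∀ R : ℝ, MeasurableSet (Metric.closedBall (0 : E × E) R) := fun R =>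
    measurableSet_closedBall
  have htight : Tendsto (fun n : ℕ => F (Metric.closedBall 0 n)ᶜ) atTop (𝓝 0) := by
    have hinter : F (⋂ n : ℕ, (Metric.closedBall (0 : E) n)ᶜ) = 0 := by
      rw [← Set.compl_iUnion, Metric.iUnion_closedBall_nat]
      simp
    rw [← hinter]
    refine tendsto_measure_iInter_atTop (fun n => (hball n).compl.nullMeasurableSet)
      (fun m n hmn => ?_) ⟨0, measure_ne_top _ _⟩
    exact Set.compl_subset_compl.2 (Metric.closedBall_subset_closedBall (Nat.cast_le.2 hmn))
  have hlim := ((ENNReal.tendsto_toReal ENNReal.zero_ne_top).comp htight).const_mul (2 * K)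
  simp only [ENNReal.toReal_zero, mul_zero, Function.comp] at hlim
  obtain ⟨R, hR⟩ := (hlim.eventually_lt_const hε).exists
  set g : E × E → ℝ := (Metric.closedBall (0 : E × E) R).indicator h with hg
  have hgm : Measurable g := h_meas.indicator (hball' R)
  have hgle : ∀ z, |g z| ≤ K := fun z => by
    by_cases hz : z ∈ Metric.closedBall (0 : E × E) R
    · rw [hg, Set.indicator_of_mem hz]; exact hK z
    · rw [hg, Set.indicator_of_notMem hz]; simpa using hK0
  have hgint : Integrable g (ν.prod ν) := by
    rw [hg, integrable_indicator_iff (hball' R)]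
    refine Measure.integrableOn_of_bounded (M := K) ?_ h_meas.aestronglyMeasurable
      (Eventually.of_forall hK)
    exact (isCompact_closedBall _ _).measure_lt_top.ne
  have happ : ∀ Q : Measure (E × E), IsProbabilityMeasure Q → Q.map Prod.fst = F →
      Q.map Prod.snd = F → ∫ z, |h z - g z| ∂Q ≤ ε := by
    intro Q hQ h1 h2
    have hpt : ∀ z, |h z - g z| ≤ (Metric.closedBall (0 : E × E) R)ᶜ.indicator (fun _ => K) z := by
      intro z
      by_cases hz : z ∈ Metric.closedBall (0 : E × E) R
      · rw [hg, Set.indicator_of_mem hz, Set.indicator_of_notMem (Set.notMem_compl_iff.2 hz)]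
        simp
      · rw [hg, Set.indicator_of_notMem hz, Set.indicator_of_mem (show z ∈ _ᶜ from hz)]
        simpa using hK z
    have hQle : Q (Metric.closedBall (0 : E × E) R)ᶜ ≤ 2 * F (Metric.closedBall 0 R)ᶜ := by
      have hsub : (Metric.closedBall (0 : E × E) (R : ℝ))ᶜ ⊆
          Prod.fst ⁻¹' (Metric.closedBall 0 R)ᶜ ∪ Prod.snd ⁻¹' (Metric.closedBall 0 R)ᶜ := by
        intro z hz
        by_contra hz'
        rw [Set.mem_union, not_or] at hz'
        refine hz ?_
        rw [show (0 : E × E) = (0, 0) from rfl, ← closedBall_prod_same]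
        exact ⟨not_not.1 hz'.1, not_not.1 hz'.2⟩
      refine (measure_mono hsub).trans ((measure_union_le _ _).trans_eq ?_)
      rw [← Measure.map_apply measurable_fst (hball R).compl,
        ← Measure.map_apply measurable_snd (hball R).compl, h1, h2, two_mul]
    calc ∫ z, |h z - g z| ∂Q
        ≤ ∫ z, (Metric.closedBall (0 : E × E) R)ᶜ.indicator (fun _ => K) z ∂Q := by
          refine integral_mono (Integrable.of_bound (h_meas.sub hgm).norm.aestronglyMeasurable
            (K + K) (Eventually.of_forall fun z => ?_))
            ((integrable_const K).indicator (hball' R).compl) hpt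
          rw [Real.norm_eq_abs, abs_abs]
          exact (abs_sub _ _).trans (add_le_add (hK z) (hgle z))
      _ = (Q (Metric.closedBall (0 : E × E) R)ᶜ).toReal * K := by
          rw [integral_indicator_const _ (hball' R).compl]; rfl
      _ ≤ (2 * F (Metric.closedBall 0 R)ᶜ).toReal * K := by
          gcongr
          exact ENNReal.mul_ne_top (by norm_num) (measure_ne_top _ _)
      _ ≤ ε := by
          rw [ENNReal.toReal_mul]
          simp only [ENNReal.toReal_ofNat]
          linarith
  refine ⟨g, hX.isLLNKernel_of_le_smul_of_integrable hgm hgle hgint hM hM',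
    fun i j hi hij => ?_, happ _ inferInstance (by simp [hF]) (by simp [hF])⟩
  have := happ (P.map fun ω => (X i ω, X j ω))
    (Measure.isProbabilityMeasure_map (hX.measurable_pair i j).aemeasurable)
    (by
      rw [Measure.map_map measurable_fst (hX.measurable_pair i j), hF, hX.map_eq 1]
      exact hX.map_eq i)
    (by
      rw [Measure.map_map measurable_snd (hX.measurable_pair i j), hF, hX.map_eq 1]
      exact hX.map_eq j)
  rwa [integral_map (f := fun z => |h z - g z|) (hX.measurable_pair i j).aemeasurable
    (h_meas.sub hgm).norm.aestronglyMeasurable] at this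

theorem IsLebesgueDensity.le_smul_volume {E : Type*} [MeasureSpace E] {f : E → ℝ≥0∞}
    {Q : Measure E} (hf : IsLebesgueDensity f Q) {M : ℝ≥0} (hM : ∀ x, f x ≤ M) :
    Q ≤ M • (volume : Measure E) := by
  rw [hf.2]
  refine (withDensity_mono (Eventually.of_forall hM)).trans_eq ?_
  rw [withDensity_const]
  rfl

end Density

theorem mainTheorem2 {Ω : Type*} [MeasurableSpace Ω] (P : Measure Ω) [IsProbabilityMeasure P]
    (d : ℕ) (X : ℕ → Ω → EuclideanSpace ℝ (Fin d)) (hX : IsStationaryErgodic X P)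
    (h : EuclideanSpace ℝ (Fin d) × EuclideanSpace ℝ (Fin d) → ℝ) (h_meas : Measurable h)
    (h_ui : UniformIntegrable (fun (j : {j : ℕ // 1 ≤ j}) ω => h (X 1 ω, X j ω)) 1 P)
    (F : Measure (EuclideanSpace ℝ (Fin d))) (hF : F = P.map (X 1))
    (hA :
      -- the kernel is almost everywhere continuous and symmetric
      ((∀ᵐ z ∂(F.prod F), ContinuousAt h z) ∧ ∀ x y, h (x, y) = h (y, x)) ∨
      -- the kernel is integrable, and the densities are uniformly bounded
      (Integrable h (F.prod F) ∧
        (∃ f₀ : EuclideanSpace ℝ (Fin d) → ℝ≥0∞, IsLebesgueDensity f₀ (P.map (X 0)) ∧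
          ∃ M : ℝ≥0, ∀ x, f₀ x ≤ M) ∧
        ∃ f : ℕ → EuclideanSpace ℝ (Fin d) × EuclideanSpace ℝ (Fin d) → ℝ≥0∞,
          (∀ k, 1 ≤ k → IsLebesgueDensity (f k) (P.map fun ω => (X 0 ω, X k ω))) ∧
          ∃ M : ℝ≥0, ∀ k, 1 ≤ k → ∀ s t, f k (s, t) ≤ M)) :
    Integrable h (F.prod F) ∧
    (∀ n, Integrable (uStatistic h X n) P) ∧
    Tendsto (fun n : ℕ => ∫ ω, |uStatistic h X n ω - ∫ y, ∫ x, h (x, y) ∂F ∂F| ∂P)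
      atTop (𝓝 0) := by
  subst hF
  have : IsProbabilityMeasure (P.map (X 1)) :=
    Measure.isProbabilityMeasure_map (hX.measurable 1).aemeasurable
  have hlln : IsLLNKernel X P h := by
    rcases hA with ⟨hcont, -⟩ | ⟨h_int, ⟨f₀, hf₀, M₀, hM₀⟩, f, hf, M, hM⟩
    · exact hX.isLLNKernel_of_ae_continuousAt_of_uniformIntegrable h_meas h_ui hcont
    · have hle₀ : P.map (X 1) ≤ M₀ • volume := by
        rw [hX.map_eq 1]
        exact hf₀.le_smul_volume hM₀
      -- A common bound for the density of the product law and for all the pair densities.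
      have hprod : (P.map (X 1)).prod (P.map (X 1)) ≤
          (M + M₀ * M₀) • (volume : Measure (EuclideanSpace ℝ (Fin d))).prod volume := by
        refine (Measure.prod_mono hle₀ hle₀).trans ?_
        rw [Measure.prod_smul_left, Measure.prod_smul_right, smul_smul, add_smul]
        exact Measure.le_add_left le_rfl
      have hpair : ∀ i j, 1 ≤ i → i < j → P.map (fun ω => (X i ω, X j ω)) ≤
          (M + M₀ * M₀) • (volume : Measure (EuclideanSpace ℝ (Fin d))).prod volume := by
        intro i j _ hij
        have hmap := hX.map_pair_add 0 (j - i) i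
        rw [zero_add, Nat.sub_add_cancel hij.le] at hmap
        rw [hmap, add_smul]
        exact Measure.le_add_right ((hf (j - i) (by omega)).le_smul_volume
          fun z => hM (j - i) (by omega) z.1 z.2)
      refine hX.isLLNKernel_of_clamp h_meas h_ui h_int fun n => ?_
      exact hX.isLLNKernel_of_le_smul_of_bounded
        ((continuous_clamp n).measurable.comp h_meas) (fun z => abs_clamp_le n.cast_nonneg _)
        hpair hprod
  refine ⟨hlln.integrable_prod, integrable_uStatistic hlln.integrable_pair, ?_⟩
  rw [← integral_prod_symm h hlln.integrable_prod]
  exact hlln.tendsto
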